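/- Let $N, K \ge 0$ be integers, let $\mathcal Z, \mathcal Z' \subset \mathbb R^N$ be convex bodies (compact, convex, with non-empty interior; $\mathcal Z' = \mathcal Z$ is allowed), let $\alpha \in [1,\infty]$ with $\alpha \neq 2$, and let $\delta$ be the $L^\alpha$ metric on $\mathbb R^N$ or, for $\alpha<\infty$, its $\alpha$-th power. Let $\lambda, \tau > 0$. Generative process. Let $\mathcal X \subseteq \mathbb R^K$ and let $g : \mathcal Z \to \mathcal X$ be injective and differentiable. A positive pair of latents $(z, \tilde z)$ is drawn as follows: $\tilde z$ is uniformly distributed on $\mathcal Z$, and given $\tilde z$ the latent $z$ has on $\mathcal Z$ the density $$p(z \mid \tilde z) = \frac{e^{-\lambda\delta(z,\tilde z)}}{\int_{\mathcal Z} e^{-\lambda\delta(w,\tilde z)}\,dw}.$$ Let $p_{\mathsf{pos}}$ be the law of $(x,\tilde x) = (g(z), g(\tilde z))$, and let $p_{\mathsf{data}}$ be the law of $g(z)$ for $z$ uniformly distributed on $\mathcal Z$. Model. For $f : \mathcal X \to \mathcal Z'$ and $h = f\circ g$ let $$q_h(z \mid \tilde z) = \frac{e^{-\delta(h(z),h(\tilde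 z))/\tau}}{\int_{\mathcal Z} e^{-\delta(h(w),h(\tilde z))/\tau}\,dw},$$ so that $p$ and $q_h$ are based on the same $\delta$ up to a constant scaling factor. For $M \in \mathbb N$ let $$\mathcal L(f; M) = \mathbb E\left[-\log \frac{e^{-\delta(f(x),f(\tilde x))/\tau}}{e^{-\delta(f(x),f(\tilde x))/\tau} + \sum_{i=1}^M e^{-\delta(f(x_i^-),f(\tilde x))/\tau}}\right],$$ where $(x,\tilde x)\sim p_{\mathsf{pos}}$ and the $x_i^- \sim p_{\mathsf{data}}$, $1 \le i \le M$, are independent of each other and of $(x,\tilde x)$. Let $\mathcal F$ be a class of maps $\mathcal X \to \mathcal Z'$ that is flexible enough for the model conditional to match the true one: there is an $f_0\in\mathcal F$ with $q_{f_0\circ g}(z\mid\tilde z) = p(z\mid\tilde z)$ for all $z,\tilde z\in\mathcal Z$. Let $f \in \mathcal F$ be differentiable on $\mathcal X$ and minimize $\mathcal L$ over $\mathcal F$ for $M\to\infty$, i.e. $\limsup_{M\to\infty}\big(\mathcal L(f;M) - \mathcal L(f';M)\big) \le 0$ for every $f' \in \mathcal F$ (if $\mathcal L(\cdot\,;M)-\log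 M$ converges as $M\to\infty$ for every member of $\mathcal F$, this says that $f$ minimizes the limit over $\mathcal F$). Then, up to a translation, $h = f\circ g$ is on $\mathcal Z$ a composition of an input-independent permutation, sign flips and a rescaling: there are a permutation $\sigma$ of $\{1,\dots,N\}$, signs $s_1,\dots,s_N\in\{1,-1\}$, a constant $c>0$ and a vector $b\in\mathbb R^N$ such that $$h(z)_i = c\, s_i\, z_{\sigma(i)} + b_i\qquad\text{for all } z\in\mathcal Z,\ 1\le i\le N.$$ -/

import Mathlib

open MeasureTheory Set Filter
open scoped ENNReal

noncomputable section

/-- A convex body in `ℝ^N`: a compact convex set with non-empty interior. -/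
def IsConvexBody {N : ℕ} (Z : Set (Fin N → ℝ)) : Prop :=
  Convex ℝ Z ∧ IsCompact Z ∧ (interior Z).Nonempty

/-- The `L^α` metric on `ℝ^N`, for `α ∈ [1, ∞]`. -/
def lpMetric {N : ℕ} (α : ℝ≥0∞) (x y : Fin N → ℝ) : ℝ :=
  dist (WithLp.toLp α x) (WithLp.toLp α y)

/-- `δ` is the `L^α` metric, or (for finite `α`) its `α`-th power. -/
def IsLpSimilarity {N : ℕ} (α : ℝ≥0∞) (δ : (Fin N → ℝ) → (Fin N → ℝ) → ℝ) : Prop :=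
  (∀ x y, δ x y = lpMetric α x y) ∨
    (α ≠ ⊤ ∧ ∀ x y, δ x y = lpMetric α x y ^ α.toReal)

/-- The uniform distribution on `Z`. -/
def uniformLaw {N : ℕ} (Z : Set (Fin N → ℝ)) : Measure (Fin N → ℝ) :=
  ProbabilityTheory.cond volume Z

/-- The ground-truth conditional density
`p(z | z') = exp (- lam * δ z z') / ∫_Z exp (- lam * δ w z') dw` on `Z`. -/
def trueCond {N : ℕ} (Z : Set (Fin N → ℝ)) (δ : (Fin N → ℝ) → (Fin N → ℝ) → ℝ) (lam : ℝ)
    (z z' : Fin N → ℝ) : ℝ :=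
  Real.exp (-(lam * δ z z')) / ∫ w in Z, Real.exp (-(lam * δ w z'))

/-- The model conditional density
`q_h(z | z') = exp (- δ (h z) (h z') / τ) / ∫_Z exp (- δ (h w) (h z') / τ) dw` on `Z`. -/
def modelCond {N : ℕ} (Z : Set (Fin N → ℝ)) (δ : (Fin N → ℝ) → (Fin N → ℝ) → ℝ) (τ : ℝ)
    (h : (Fin N → ℝ) → (Fin N → ℝ)) (z z' : Fin N → ℝ) : ℝ :=
  Real.exp (-δ (h z) (h z') / τ) / ∫ w in Z, Real.exp (-δ (h w) (h z') / τ)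

/-- The law of a positive pair `(z, z')` of latents: `z'` is uniform on `Z` and, given `z'`,
the latent `z` has density `p(· | z')` on `Z`. -/
def latentPairLaw {N : ℕ} (Z : Set (Fin N → ℝ)) (δ : (Fin N → ℝ) → (Fin N → ℝ) → ℝ) (lam : ℝ) :
    Measure ((Fin N → ℝ) × (Fin N → ℝ)) :=
  ((volume.restrict Z).prod (uniformLaw Z)).withDensity
    fun q => ENNReal.ofReal (trueCond Z δ lam q.1 q.2)

/-- The distribution of all observations `x = g z`, `z` uniform on `Z`. -/
def dataLaw {N K : ℕ} (Z : Set (Fin N → ℝ)) (g : (Fin N → ℝ) → (Fin K → ℝ)) :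
    Measure (Fin K → ℝ) :=
  (uniformLaw Z).map g

/-- The distribution of positive pairs of observations `(x, x') = (g z, g z')`. -/
def posLaw {N K : ℕ} (Z : Set (Fin N → ℝ)) (δ : (Fin N → ℝ) → (Fin N → ℝ) → ℝ) (lam : ℝ)
    (g : (Fin N → ℝ) → (Fin K → ℝ)) : Measure ((Fin K → ℝ) × (Fin K → ℝ)) :=
  (latentPairLaw Z δ lam).map (Prod.map g g)

/-- The integrand of the contrastive loss, at a positive pair `(x, x')` and `M` negative
samples `xneg`. -/
def contrastiveTerm {N K : ℕ} (δ : (Fin N → ℝ) → (Fin N → ℝ) → ℝ) (τ : ℝ)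
    (f : (Fin K → ℝ) → (Fin N → ℝ)) (M : ℕ) (x x' : Fin K → ℝ) (xneg : Fin M → Fin K → ℝ) : ℝ :=
  -Real.log (Real.exp (-δ (f x) (f x') / τ) /
    (Real.exp (-δ (f x) (f x') / τ) + ∑ i, Real.exp (-δ (f (xneg i)) (f x') / τ)))

/-- The contrastive (general InfoNCE) loss with similarity measure `δ`, temperature `τ` and
`M` negative samples, drawn independently of each other and of the positive pair. -/
def contrastiveLoss {N K : ℕ} (δ : (Fin N → ℝ) → (Fin N → ℝ) → ℝ) (τ : ℝ)
    (Ppos : Measure ((Fin K → ℝ) × (Fin K → ℝ))) (Pdata : Measure (Fin K → ℝ))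
    (f : (Fin K → ℝ) → (Fin N → ℝ)) (M : ℕ) : ℝ :=
  ∫ ω : ((Fin K → ℝ) × (Fin K → ℝ)) × (Fin M → Fin K → ℝ),
    contrastiveTerm δ τ f M ω.1.1 ω.1.2 ω.2 ∂(Ppos.prod (Measure.pi fun _ => Pdata))

/-- `f` minimizes, over the class `F`, the sequence of objectives `L · M` in the limit `M → ∞`:
for each competitor `f'` in `F`, the limit superior of `L f M - L f' M` is at most `0`. If
`L f M - log M` converges for all `f` in `F`, then this says that `f` minimizes the limit
over `F` (the normalization `log M` cancels). -/
def IsAsymptoticMinimizer {A : Type*} (L : A → ℕ → ℝ) (F : Set A) (f : A) : Prop :=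
  f ∈ F ∧ ∀ f' ∈ F, ∀ ε : ℝ, 0 < ε → ∀ᶠ M : ℕ in atTop, L f M ≤ L f' M + ε

end

/-! ### Linear isometries of `ℓ^p` -/

/-! As `M → ∞` the sum over negatives obeys the law of large numbers, so the loss minus `log M`
tends to the cross-entropy of the model conditional relative to the true one
(`tendsto_contrastive_sub_log`). The matching encoder attains the entropy of the true conditional,
so a minimizer does no worse, and the equality case of Gibbs' inequality
(`condDensity_ae_eq_of_crossEntropy_le`) makes its conditional equal to the true one almost
everywhere. By continuity equality holds on all of `Z`. On the diagonal `δ` vanishes, so the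
normalizers agree, and taking logarithms gives `δ (h z) (h z') = τ * lam * δ z z'`: `h` multiplies
the `L^α` metric by a constant `c`.

No surjectivity is available for a Mazur–Ulam argument; differentiability replaces it. At each
interior point the derivative multiplies the `ℓ^α` norm by `c`, hence for `α ≠ 2` is `c` times a
signed permutation (`LinearMap.exists_signed_perm_of_norm_eq`): for finite `α` such a map preserves
disjointness of supports, by the equality case of a Clarkson inequality, and for `α = ∞` a row-sum
estimate applies. Signed permutations are finite in number and derivatives have the Darboux
property, so along segments the derivative cannot jump, and `h` is affine
(`exists_signed_perm_of_lpMetric_eq`). -/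

theorem Real.rpow_add_rpow_lt_add_rpow {q a b : ℝ} (hq : 1 < q) (ha : 0 < a) (hb : 0 < b) :
    a ^ q + b ^ q < (a + b) ^ q := by
  have key : ∀ x : ℝ, 0 < x → x ^ q = x * x ^ (q - 1) := fun x hx => by
    rw [Real.rpow_sub_one hx.ne']; field_simp
  rw [key a ha, key b hb, key (a + b) (by positivity)]
  have h1 : a ^ (q - 1) < (a + b) ^ (q - 1) :=
    Real.rpow_lt_rpow ha.le (by linarith) (by linarith)
  have h2 : b ^ (q - 1) < (a + b) ^ (q - 1) :=
    Real.rpow_lt_rpow hb.le (by linarith) (by linarith)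
  nlinarith [mul_lt_mul_of_pos_left h1 ha, mul_lt_mul_of_pos_left h2 hb]

theorem Real.add_rpow_lt_rpow_add_rpow {q a b : ℝ} (hq : q < 1) (ha : 0 < a) (hb : 0 < b) :
    (a + b) ^ q < a ^ q + b ^ q := by
  have key : ∀ x : ℝ, 0 < x → x ^ q = x * x ^ (q - 1) := fun x hx => by
    rw [Real.rpow_sub_one hx.ne']; field_simp
  rw [key a ha, key b hb, key (a + b) (by positivity)]
  have h1 : (a + b) ^ (q - 1) < a ^ (q - 1) :=
    Real.rpow_lt_rpow_of_neg ha (by linarith) (by linarith)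
  have h2 : (a + b) ^ (q - 1) < b ^ (q - 1) :=
    Real.rpow_lt_rpow_of_neg hb (by linarith) (by linarith)
  nlinarith [mul_lt_mul_of_pos_left h1 ha, mul_lt_mul_of_pos_left h2 hb]

theorem Real.abs_rpow_eq_sq_rpow (x p : ℝ) : |x| ^ p = (x ^ 2) ^ (p / 2) := by
  rw [← sq_abs x, ← Real.rpow_natCast, ← Real.rpow_mul (abs_nonneg x)]
  congr 1
  push_cast
  ring

/-- The defect in Clarkson's equality for two real numbers. -/
noncomputable def clarksonDefect (p a b : ℝ) : ℝ :=
  |a + b| ^ p + |a - b| ^ p - 2 * (|a| ^ p + |b| ^ p)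

theorem clarksonDefect_of_mul_eq_zero {p a b : ℝ} (hp : 0 < p) (h : a * b = 0) :
    clarksonDefect p a b = 0 := by
  rcases mul_eq_zero.1 h with rfl | rfl
  · simp [clarksonDefect, Real.zero_rpow hp.ne']; ring
  · simp [clarksonDefect, Real.zero_rpow hp.ne']; ring

/-- The mean of `(a + b) ^ 2` and `(a - b) ^ 2` is `a ^ 2 + b ^ 2`. Convexity of `x ^ (p / 2)`
followed by its strict superadditivity gives the sign; for `p < 2` both inequalities reverse. -/
theorem clarksonDefect_pos {p a b : ℝ} (hp : 2 < p) (h : a * b ≠ 0) :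
    0 < clarksonDefect p a b := by
  have ha : 0 < a ^ 2 := by have := left_ne_zero_of_mul h; positivity
  have hb : 0 < b ^ 2 := by have := right_ne_zero_of_mul h; positivity
  have h1 := Real.rpow_add_rpow_lt_add_rpow (q := p / 2) (by linarith) ha hb
  have h2 := (convexOn_rpow (p := p / 2) (by linarith)).2
    (mem_Ici.2 (sq_nonneg (a + b))) (mem_Ici.2 (sq_nonneg (a - b)))
    (show (0 : ℝ) ≤ 1 / 2 by norm_num) (show (0 : ℝ) ≤ 1 / 2 by norm_num) (by norm_num)
  simp only [smul_eq_mul] at h2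
  rw [show 1 / 2 * (a + b) ^ 2 + 1 / 2 * (a - b) ^ 2 = a ^ 2 + b ^ 2 by ring] at h2
  simp only [clarksonDefect, Real.abs_rpow_eq_sq_rpow]
  linarith

theorem clarksonDefect_neg {p a b : ℝ} (hp0 : 0 < p) (hp : p < 2) (h : a * b ≠ 0) :
    clarksonDefect p a b < 0 := by
  have ha : 0 < a ^ 2 := by have := left_ne_zero_of_mul h; positivity
  have hb : 0 < b ^ 2 := by have := right_ne_zero_of_mul h; positivity
  have h1 := Real.add_rpow_lt_rpow_add_rpow (q := p / 2) (by linarith) ha hb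
  have h2 := (Real.concaveOn_rpow (p := p / 2) (by linarith) (by linarith)).2
    (mem_Ici.2 (sq_nonneg (a + b))) (mem_Ici.2 (sq_nonneg (a - b)))
    (show (0 : ℝ) ≤ 1 / 2 by norm_num) (show (0 : ℝ) ≤ 1 / 2 by norm_num) (by norm_num)
  simp only [smul_eq_mul] at h2
  rw [show 1 / 2 * (a + b) ^ 2 + 1 / 2 * (a - b) ^ 2 = a ^ 2 + b ^ 2 by ring] at h2
  simp only [clarksonDefect, Real.abs_rpow_eq_sq_rpow]
  linarith

theorem mul_eq_zero_of_sum_clarksonDefect_eq_zero {ι : Type*} [Fintype ι] {p : ℝ} (hp0 : 0 < p)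
    (hp : p ≠ 2) {u v : ι → ℝ} (h : ∑ k, clarksonDefect p (u k) (v k) = 0) (k : ι) :
    u k * v k = 0 := by
  by_contra hk
  rcases hp.lt_or_gt with hp | hp
  · have hle : ∀ j ∈ Finset.univ, clarksonDefect p (u j) (v j) ≤ 0 := fun j _ => by
      by_cases hj : u j * v j = 0
      · exact (clarksonDefect_of_mul_eq_zero hp0 hj).le
      · exact (clarksonDefect_neg hp0 hp hj).le
    exact (clarksonDefect_neg hp0 hp hk).ne
      ((Finset.sum_eq_zero_iff_of_nonpos hle).1 h k (Finset.mem_univ k))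
  · have hle : ∀ j ∈ Finset.univ, 0 ≤ clarksonDefect p (u j) (v j) := fun j _ => by
      by_cases hj : u j * v j = 0
      · exact (clarksonDefect_of_mul_eq_zero hp0 hj).ge
      · exact (clarksonDefect_pos hp hj).le
    exact (clarksonDefect_pos hp hk).ne'
      ((Finset.sum_eq_zero_iff_of_nonneg hle).1 h k (Finset.mem_univ k))

theorem PiLp.norm_toLp_rpow {ι : Type*} [Fintype ι] {α : ℝ≥0∞} (hα : 0 < α.toReal) (v : ι → ℝ) :
    ‖WithLp.toLp α v‖ ^ α.toReal = ∑ k, |v k| ^ α.toReal := by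
  rw [PiLp.norm_eq_sum hα, ← Real.rpow_mul (Finset.sum_nonneg fun k _ => by positivity),
    one_div, inv_mul_cancel₀ hα.ne', Real.rpow_one]
  simp

section LinearIsometry

variable {ι : Type*} [Fintype ι] [DecidableEq ι] {α : ℝ≥0∞} {c : ℝ} {A : (ι → ℝ) →ₗ[ℝ] (ι → ℝ)}

/-- The total Clarkson defect involves only `p`-th powers of norms, so `A` multiplies it by `c ^ p`.
It vanishes for two distinct basis vectors, hence for their images; as all its terms have one sign,
the images have disjoint supports. -/
theorem LinearMap.mul_apply_single_eq_zero_of_norm_eq (hα : 1 ≤ α) (hα2 : α ≠ 2) (hαt : α ≠ ⊤)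
    (hc : 0 < c) (hA : ∀ v, ‖WithLp.toLp α (A v)‖ = c * ‖WithLp.toLp α v‖) {i j : ι} (hij : i ≠ j)
    (k : ι) : A (Pi.single i 1) k * A (Pi.single j 1) k = 0 := by
  have hp : 0 < α.toReal := ENNReal.toReal_pos (by rintro rfl; simp at hα) hαt
  have hp2 : α.toReal ≠ 2 := fun h => hα2 <| by
    rw [← ENNReal.ofReal_toReal hαt, h]; norm_num
  have : Fact (1 ≤ α) := ⟨hα⟩
  have hpow : ∀ v, ∑ k, |A v k| ^ α.toReal = c ^ α.toReal * ∑ k, |v k| ^ α.toReal := fun v => by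
    rw [← PiLp.norm_toLp_rpow hp, ← PiLp.norm_toLp_rpow hp, hA,
      Real.mul_rpow hc.le (norm_nonneg _)]
  refine mul_eq_zero_of_sum_clarksonDefect_eq_zero hp hp2
    (u := A (Pi.single i 1)) (v := A (Pi.single j 1)) ?_ k
  have hz : ∑ k, clarksonDefect α.toReal ((Pi.single i (1 : ℝ) : ι → ℝ) k)
      ((Pi.single j (1 : ℝ) : ι → ℝ) k) = 0 := by
    refine Finset.sum_eq_zero fun k _ => clarksonDefect_of_mul_eq_zero hp ?_
    by_cases hk : k = i
    · subst hk; simp [hij]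
    · simp [hk]
  have h1 := hpow (Pi.single i 1 + Pi.single j 1)
  have h2 := hpow (Pi.single i 1 - Pi.single j 1)
  have h3 := hpow (Pi.single i 1)
  have h4 := hpow (Pi.single j 1)
  simp only [map_add, map_sub, Pi.add_apply, Pi.sub_apply] at h1 h2
  simp only [clarksonDefect, Finset.sum_sub_distrib, Finset.sum_add_distrib,
    ← Finset.mul_sum] at hz ⊢
  rw [h1, h2, h3, h4]
  linear_combination c ^ α.toReal * hz

theorem LinearMap.apply_eq_sum_single (v : ι → ℝ) (k : ι) :
    A v k = ∑ j, A (Pi.single j 1) k * v j := by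
  conv_lhs => rw [LinearMap.pi_apply_eq_sum_univ A v]
  simp only [Finset.sum_apply, Pi.smul_apply, smul_eq_mul]
  refine Finset.sum_congr rfl fun j _ => ?_
  have hj : (fun l => if j = l then (1 : ℝ) else 0) = Pi.single j 1 := by
    ext l
    simp [Pi.single_apply, eq_comm]
  rw [mul_comm, hj]

/-- Testing `A` on the sign vector of a row bounds the `ℓ¹` norm of that row by `c`. Column `j` has
norm `c`, so its largest entry already exhausts its row. -/
theorem LinearMap.exists_abs_eq_of_norm_top_eq (hc : 0 < c)
    (hA : ∀ v, ‖A v‖ = c * ‖v‖) (j : ι) :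
    ∃ k, A (Pi.single j 1) k ≠ 0 ∧ ∀ i ≠ j, A (Pi.single i 1) k = 0 := by
  have hrow : ∀ k, ∑ i, |A (Pi.single i 1) k| ≤ c := fun k => by
    have h1 : A (fun i => SignType.sign (A (Pi.single i 1) k)) k = ∑ i, |A (Pi.single i 1) k| := by
      rw [LinearMap.apply_eq_sum_single]
      exact Finset.sum_congr rfl fun i _ => self_mul_sign _
    rw [← h1]
    refine (le_abs_self _).trans ((norm_le_pi_norm (A _) k).trans ?_)
    rw [hA]
    refine mul_le_of_le_one_right hc.le ((pi_norm_le_iff_of_nonneg zero_le_one).2 fun i => ?_)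
    rcases lt_trichotomy (A (Pi.single i 1) k) 0 with h | h | h <;> simp [h]
  have : Nonempty ι := ⟨j⟩
  obtain ⟨k, -, hk⟩ := Finset.exists_max_image Finset.univ (fun k => |A (Pi.single j 1) k|)
    Finset.univ_nonempty
  have hck : c ≤ |A (Pi.single j 1) k| := by
    have := hA (Pi.single j 1)
    rw [Pi.norm_single, norm_one, mul_one] at this
    rw [← this]
    exact (pi_norm_le_iff_of_nonneg (abs_nonneg _)).2 fun l => hk l (Finset.mem_univ l)
  refine ⟨k, abs_pos.1 (hc.trans_le hck), fun i hi => ?_⟩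
  have h2 : |A (Pi.single i 1) k| + |A (Pi.single j 1) k| ≤ c := by
    rw [← Finset.sum_pair hi (f := fun i => |A (Pi.single i 1) k|)]
    exact (Finset.sum_le_sum_of_subset_of_nonneg (Finset.subset_univ _)
      fun _ _ _ => abs_nonneg _).trans (hrow k)
  exact abs_eq_zero.1 (le_antisymm (by linarith) (abs_nonneg _))

theorem LinearMap.exists_apply_single_ne_zero (hα : 1 ≤ α) (hα2 : α ≠ 2)
    (hc : 0 < c) (hA : ∀ v, ‖WithLp.toLp α (A v)‖ = c * ‖WithLp.toLp α v‖) (j : ι) :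
    ∃ k, A (Pi.single j 1) k ≠ 0 ∧ ∀ i ≠ j, A (Pi.single i 1) k = 0 := by
  by_cases hαt : α = ⊤
  · subst hαt
    exact LinearMap.exists_abs_eq_of_norm_top_eq hc (fun v => by simpa using hA v) j
  have : Fact (1 ≤ α) := ⟨hα⟩
  have hne : A (Pi.single j 1) ≠ 0 := fun h => by
    have := hA (Pi.single j 1)
    rw [h, PiLp.toLp_single, PiLp.norm_single] at this
    simp at this
    exact hc.ne this
  obtain ⟨k, hk⟩ := Function.ne_iff.1 hne
  exact ⟨k, hk, fun i hi => (mul_eq_zero.1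
    (LinearMap.mul_apply_single_eq_zero_of_norm_eq hα hα2 hαt hc hA hi k)).resolve_right hk⟩

/-- For `α ≠ 2`, a linear map scaling the `ℓ^α` norm by `c` is `c` times a signed permutation. -/
theorem LinearMap.exists_signed_perm_of_norm_eq (hα : 1 ≤ α) (hα2 : α ≠ 2)
    (hc : 0 < c) (hA : ∀ v, ‖WithLp.toLp α (A v)‖ = c * ‖WithLp.toLp α v‖) :
    ∃ (σ : Equiv.Perm ι) (s : ι → ℝ), (∀ i, s i = 1 ∨ s i = -1) ∧
      ∀ v i, A v i = c * (s i * v (σ i)) := by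
  have : Fact (1 ≤ α) := ⟨hα⟩
  choose k hk0 hk using LinearMap.exists_apply_single_ne_zero hα hα2 hc hA
  -- Row `k i` is supported in column `i` alone, so two columns cannot share a row.
  have hinj : Function.Injective k := fun i j hij => by
    by_contra hne
    exact hk0 i (hij ▸ hk j i hne)
  let e : ι ≃ ι := Equiv.ofBijective k (Finite.injective_iff_bijective.1 hinj)
  have hek : ∀ i, k (e.symm i) = i := fun i => e.apply_symm_apply i
  have hrow : ∀ i j, j ≠ e.symm i → A (Pi.single j 1) i = 0 := fun i j hj => by
    have := hk (e.symm i) j hj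
    rwa [hek] at this
  have habs : ∀ i, |A (Pi.single (e.symm i) 1) i| = c := fun i => by
    -- Every other row is supported in a different column, so this column has a single nonzero
    -- entry, whose size is then its norm `c`.
    have h1 : A (Pi.single (e.symm i) 1) = Pi.single i (A (Pi.single (e.symm i) 1) i) := by
      ext l
      by_cases hl : l = i
      · subst hl; simp
      · rw [Pi.single_eq_of_ne hl]
        exact hrow l _ fun h => hl (e.symm.injective h).symm
    have h2 := hA (Pi.single (e.symm i) 1)
    rw [h1, PiLp.toLp_single, PiLp.toLp_single, PiLp.norm_single, PiLp.norm_single] at h2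
    simpa using h2
  refine ⟨e.symm, fun i => A (Pi.single (e.symm i) 1) i / c, fun i => ?_, fun v i => ?_⟩
  · rcases abs_choice (A (Pi.single (e.symm i) 1) i) with h | h <;> rw [habs] at h
    · left; exact (div_eq_one_iff_eq hc.ne').2 h.symm
    · right; beta_reduce; rw [div_eq_iff hc.ne']; linarith
  · rw [LinearMap.apply_eq_sum_single, Finset.sum_eq_single (e.symm i)
      (fun j _ hj => by rw [hrow i j hj, zero_mul]) (by simp)]
    field_simp

end LinearIsometry

/-! ### Differentiable scaled isometries of convex bodies -/

/-- By Darboux the values of the derivative form an interval; being finite, it is a point, and the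
mean value theorem applies. Only continuity is asked at `0`, since that end of the segment may lie
on the boundary of the body. -/
theorem eq_sub_deriv_of_finite_image {φ φ' : ℝ → ℝ} {S : Set ℝ} (hS : S.Finite)
    (hφ : ContinuousOn φ (Icc 0 1)) (hd : ∀ t ∈ Ioc (0 : ℝ) 1, HasDerivAt φ (φ' t) t)
    (hφ' : ∀ t ∈ Ioc (0 : ℝ) 1, φ' t ∈ S) : φ 0 = φ 1 - φ' 1 := by
  have hord : OrdConnected (φ' '' Ioc 0 1) :=
    ordConnected_Ioc.image_hasDerivWithinAt fun t ht => (hd t ht).hasDerivWithinAt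
  have hfin : (φ' '' Ioc 0 1).Finite := hS.subset (image_subset_iff.2 hφ')
  have hsub : (φ' '' Ioc 0 1).Subsingleton := by
    intro a ha b hb
    by_contra hab
    rcases lt_or_gt_of_ne hab with h | h
    · exact Icc_infinite h (hfin.subset (hord.out ha hb))
    · exact Icc_infinite h (hfin.subset (hord.out hb ha))
  obtain ⟨t, ht, h⟩ := exists_hasDerivAt_eq_slope φ φ' zero_lt_one hφ
    fun t ht => hd t (Ioo_subset_Ioc_self ht)
  have := hsub (mem_image_of_mem φ' (Ioo_subset_Ioc_self ht))
    (mem_image_of_mem φ' (right_mem_Ioc.2 zero_lt_one))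
  rw [← this, h]
  ring

/-- For small `t > 0` the difference quotient in direction `v` has norm exactly `c * ‖v‖`, and this
passes to the limit. -/
theorem norm_fderiv_eq_of_lpMetric_eq {N : ℕ} {α : ℝ≥0∞} (hα : 1 ≤ α) {Z : Set (Fin N → ℝ)}
    {h : (Fin N → ℝ) → (Fin N → ℝ)} {c : ℝ}
    (hiso : ∀ z ∈ Z, ∀ w ∈ Z, lpMetric α (h z) (h w) = c * lpMetric α z w)
    {x : Fin N → ℝ} (hx : x ∈ interior Z) {A : (Fin N → ℝ) →L[ℝ] (Fin N → ℝ)}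
    (hA : HasFDerivAt h A x) (v : Fin N → ℝ) :
    ‖WithLp.toLp α (A v)‖ = c * ‖WithLp.toLp α v‖ := by
  have : Fact (1 ≤ α) := ⟨hα⟩
  have hline := (hA.hasLineDerivAt v).tendsto_slope_zero_right
  have hcont : Continuous fun u : Fin N → ℝ => ‖WithLp.toLp α u‖ :=
    (PiLp.continuous_toLp α _).norm
  refine tendsto_nhds_unique ((hcont.tendsto _).comp hline) (tendsto_const_nhds.congr' ?_)
  have hmem : ∀ᶠ t : ℝ in nhdsWithin 0 (Ioi 0), x + t • v ∈ Z := by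
    have : Continuous fun t : ℝ => x + t • v := by fun_prop
    have h2 := this.tendsto 0
    simp only [zero_smul, add_zero] at h2
    exact (h2.eventually (mem_interior_iff_mem_nhds.1 hx)).filter_mono nhdsWithin_le_nhds
  filter_upwards [hmem, self_mem_nhdsWithin] with t ht ht0
  have ht0 : 0 < t := ht0
  have h1 := hiso _ ht _ (interior_subset hx)
  simp only [lpMetric, dist_eq_norm, ← WithLp.toLp_sub] at h1
  simp only [Function.comp, WithLp.toLp_smul, norm_smul, h1]
  simp [norm_smul, abs_of_pos ht0]
  field_simp

theorem exists_signed_perm_of_lpMetric_eq {N : ℕ} {α : ℝ≥0∞} (hα : 1 ≤ α) (hα2 : α ≠ 2)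
    {Z : Set (Fin N → ℝ)} (hZ : Convex ℝ Z) (hZi : (interior Z).Nonempty)
    {h : (Fin N → ℝ) → (Fin N → ℝ)} (hd : DifferentiableOn ℝ h Z) {c : ℝ} (hc : 0 < c)
    (hiso : ∀ z ∈ Z, ∀ w ∈ Z, lpMetric α (h z) (h w) = c * lpMetric α z w) :
    ∃ (σ : Equiv.Perm (Fin N)) (s : Fin N → ℝ) (b : Fin N → ℝ),
      (∀ i, s i = 1 ∨ s i = -1) ∧ ∀ z ∈ Z, ∀ i, h z i = c * (s i * z (σ i)) + b i := by
  obtain ⟨x, hx⟩ := hZi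
  have hfd : ∀ y ∈ interior Z, HasFDerivAt h (fderiv ℝ h y) y := fun y hy =>
    (hd.differentiableAt (mem_interior_iff_mem_nhds.1 hy)).hasFDerivAt
  have hperm : ∀ y ∈ interior Z, ∃ (σ : Equiv.Perm (Fin N)) (s : Fin N → ℝ),
      (∀ i, s i = 1 ∨ s i = -1) ∧ ∀ v i, fderiv ℝ h y v i = c * (s i * v (σ i)) := fun y hy =>
    LinearMap.exists_signed_perm_of_norm_eq (A := (fderiv ℝ h y : (Fin N → ℝ) →ₗ[ℝ] (Fin N → ℝ)))
      hα hα2 hc (norm_fderiv_eq_of_lpMetric_eq hα hiso hy (hfd y hy))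
  obtain ⟨σ, s, hs, hσ⟩ := hperm x hx
  refine ⟨σ, s, fun i => h x i - c * (s i * x (σ i)), hs, fun z hz i => ?_⟩
  -- Joins `z` to the fixed interior point `x`; all of it except possibly `z` is interior. The
  -- derivative at `x` thus determines `h z`, with the same `σ` and `s` for every `z`.
  set l : ℝ → Fin N → ℝ := fun t => z + t • (x - z) with hl
  have hl1 : l 1 = x := by simp [hl]
  have hl0 : l 0 = z := by simp [hl]
  have hlc : Continuous l := by fun_prop
  have hmem : ∀ t ∈ Ioc (0 : ℝ) 1, l t ∈ interior Z := fun t ht =>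
    hZ.add_smul_sub_mem_interior hz hx ht
  have hmemZ : MapsTo l (Icc 0 1) Z := fun t ht => by
    rcases ht.1.eq_or_lt with rfl | h0
    · rwa [hl0]
    · exact interior_subset (hmem t ⟨h0, ht.2⟩)
  have key := eq_sub_deriv_of_finite_image (φ := fun t => h (l t) i)
    (φ' := fun t => fderiv ℝ h (l t) (x - z) i)
    -- The at most `2 * N` values that coordinate `i` of a scaled signed permutation can take at `x
    -- - z`.
    (S := (range fun j => c * (1 * (x - z) j)) ∪ range fun j => c * (-1 * (x - z) j))
    ((finite_range _).union (finite_range _))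
    ((continuous_apply i).comp_continuousOn (hd.continuousOn.comp hlc.continuousOn hmemZ))
    (fun t ht => by
      have hlt : HasDerivAt l (x - z) t := by
        simpa only [one_smul, id] using ((hasDerivAt_id t).smul_const (x - z)).const_add z
      exact hasDerivAt_pi.1 ((hfd _ (hmem t ht)).comp_hasDerivAt t hlt) i)
    (fun t ht => by
      obtain ⟨σ', s', hs', hσ'⟩ := hperm _ (hmem t ht)
      simp only [hσ']
      rcases hs' i with h | h <;> rw [h]
      · exact Or.inl ⟨_, rfl⟩
      · exact Or.inr ⟨_, rfl⟩)
  simp only [hl0, hl1, hσ] at key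
  rw [key]
  simp only [Pi.sub_apply]
  ring

/-! ### Normalized kernels and the large-sample limit of the contrastive loss -/

theorem Real.abs_log_sub_log_le {m a b : ℝ} (hm : 0 < m) (ha : m ≤ a) (hb : m ≤ b) :
    |Real.log a - Real.log b| ≤ |a - b| / m := by
  have key : ∀ x y : ℝ, m ≤ x → m ≤ y → Real.log x - Real.log y ≤ |x - y| / m := fun x y hx hy => by
    have hx0 := hm.trans_le hx
    have hy0 := hm.trans_le hy
    rw [← Real.log_div hx0.ne' hy0.ne']
    calc Real.log (x / y) ≤ x / y - 1 := Real.log_le_sub_one_of_pos (div_pos hx0 hy0)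
      _ = (x - y) / y := by field_simp
      _ ≤ |x - y| / y := by gcongr; exact le_abs_self _
      _ ≤ |x - y| / m := by gcongr
  refine abs_sub_le_iff.2 ⟨key a b ha hb, ?_⟩
  rw [abs_sub_comm a b]
  exact key b a hb ha

/-- The kernel `s`, normalized in its first argument with respect to `ν`. -/
noncomputable def condDensity {A : Type*} [MeasurableSpace A] (ν : Measure A) (s : A × A → ℝ)
    (q : A × A) : ℝ :=
  s q / ∫ w, s (w, q.2) ∂ν

section Kernel

variable {A : Type*} [MeasurableSpace A] {ν : Measure A} [IsProbabilityMeasure ν]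
  {s t : A × A → ℝ} {m : ℝ}

theorem integrable_of_le_of_le {μ : Measure A} [IsFiniteMeasure μ] {X : A → ℝ}
    (hX : Measurable X) {a b : ℝ} (ha : ∀ x, a ≤ X x) (hb : ∀ x, X x ≤ b) : Integrable X μ :=
  Integrable.of_mem_Icc a b hX.aemeasurable (ae_of_all _ fun x => ⟨ha x, hb x⟩)

theorem measurable_integral_kernel (hs : Measurable s) :
    Measurable fun x' => ∫ w, s (w, x') ∂ν :=
  (hs.stronglyMeasurable.integral_prod_left' (μ := ν)).measurable

theorem le_integral_kernel (hs : Measurable s) (h0 : ∀ q, m ≤ s q) (h1 : ∀ q, s q ≤ 1) (x' : A) :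
    m ≤ ∫ w, s (w, x') ∂ν := by
  have := integral_mono (μ := ν) (integrable_const m)
    (integrable_of_le_of_le (hs.comp measurable_prodMk_right) (fun w => h0 (w, x'))
      fun w => h1 (w, x')) fun w => h0 (w, x')
  simpa using this

theorem integral_kernel_le (hs : Measurable s) (h0 : ∀ q, m ≤ s q) (h1 : ∀ q, s q ≤ 1) (x' : A) :
    ∫ w, s (w, x') ∂ν ≤ 1 := by
  have := integral_mono (μ := ν)
    (integrable_of_le_of_le (hs.comp measurable_prodMk_right) (fun w => h0 (w, x'))
      fun w => h1 (w, x')) (integrable_const 1) fun w => h1 (w, x')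
  simpa using this

theorem measurable_condDensity (hs : Measurable s) : Measurable (condDensity ν s) :=
  hs.div ((measurable_integral_kernel hs).comp measurable_snd)

/-- The normalizer lies in `[m, 1]`, which confines the density to `[m, m⁻¹]` and makes every later
integrability question one of boundedness. -/
theorem le_condDensity (hm : 0 < m) (hs : Measurable s) (h0 : ∀ q, m ≤ s q) (h1 : ∀ q, s q ≤ 1)
    (q : A × A) : m ≤ condDensity ν s q := by
  have h2 := le_integral_kernel (ν := ν) hs h0 h1 q.2
  rw [condDensity, le_div_iff₀ (hm.trans_le h2)]
  exact (mul_le_of_le_one_right hm.le (integral_kernel_le hs h0 h1 q.2)).trans (h0 q)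

theorem condDensity_le (hm : 0 < m) (hs : Measurable s) (h0 : ∀ q, m ≤ s q) (h1 : ∀ q, s q ≤ 1)
    (q : A × A) : condDensity ν s q ≤ m⁻¹ := by
  have h2 := le_integral_kernel (ν := ν) hs h0 h1 q.2
  rw [condDensity, div_le_iff₀ (hm.trans_le h2)]
  refine (h1 q).trans ?_
  rw [← inv_mul_cancel₀ hm.ne']
  gcongr

theorem abs_log_condDensity_le (hm : 0 < m) (hs : Measurable s) (h0 : ∀ q, m ≤ s q)
    (h1 : ∀ q, s q ≤ 1) (q : A × A) : |Real.log (condDensity ν s q)| ≤ -Real.log m := by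
  have h2 := le_condDensity (ν := ν) hm hs h0 h1 q
  rw [abs_le]
  refine ⟨by rw [neg_neg]; exact Real.log_le_log hm h2, ?_⟩
  rw [← Real.log_inv]
  exact Real.log_le_log (hm.trans_le h2) (condDensity_le hm hs h0 h1 q)

theorem integrable_condDensity (hm : 0 < m) (hs : Measurable s) (h0 : ∀ q, m ≤ s q)
    (h1 : ∀ q, s q ≤ 1) {μ : Measure (A × A)} [IsFiniteMeasure μ] :
    Integrable (condDensity ν s) μ :=
  integrable_of_le_of_le (measurable_condDensity hs) (le_condDensity hm hs h0 h1)
    (condDensity_le hm hs h0 h1)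

theorem integrable_log_condDensity (hm : 0 < m) (hs : Measurable s) (h0 : ∀ q, m ≤ s q)
    (h1 : ∀ q, s q ≤ 1) {μ : Measure (A × A)} [IsFiniteMeasure μ] :
    Integrable (fun q => Real.log (condDensity ν s q)) μ :=
  integrable_of_le_of_le (measurable_condDensity hs).log
    (fun q => (abs_le.1 (abs_log_condDensity_le hm hs h0 h1 q)).1)
    (fun q => (abs_le.1 (abs_log_condDensity_le hm hs h0 h1 q)).2)

theorem integral_condDensity (hm : 0 < m) (hs : Measurable s) (h0 : ∀ q, m ≤ s q)
    (h1 : ∀ q, s q ≤ 1) : ∫ q, condDensity ν s q ∂(ν.prod ν) = 1 := by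
  rw [integral_prod_symm _ (integrable_condDensity hm hs h0 h1)]
  simp only [condDensity, integral_div]
  rw [integral_congr_ae (ae_of_all _ fun x' =>
    div_self (hm.trans_le (le_integral_kernel hs h0 h1 x')).ne')]
  simp

theorem isProbabilityMeasure_withDensity_condDensity (hm : 0 < m) (hs : Measurable s)
    (h0 : ∀ q, m ≤ s q) (h1 : ∀ q, s q ≤ 1) :
    IsProbabilityMeasure ((ν.prod ν).withDensity fun q => ENNReal.ofReal (condDensity ν s q)) := by
  refine ⟨?_⟩
  rw [withDensity_apply _ MeasurableSet.univ, Measure.restrict_univ,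
    ← ofReal_integral_eq_lintegral_ofReal (integrable_condDensity hm hs h0 h1)
      (ae_of_all _ fun q => hm.le.trans (le_condDensity hm hs h0 h1 q)),
    integral_condDensity hm hs h0 h1, ENNReal.ofReal_one]

/-- If the normalized kernel of `t` has at most the cross-entropy of the normalized kernel of `s`
relative to the latter, then the two agree almost everywhere. -/
theorem condDensity_ae_eq_of_crossEntropy_le (hm : 0 < m) (hs : Measurable s) (hs0 : ∀ q, m ≤ s q)
    (hs1 : ∀ q, s q ≤ 1) (ht : Measurable t) (ht0 : ∀ q, m ≤ t q) (ht1 : ∀ q, t q ≤ 1)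
    (hle : ∫ q, -Real.log (condDensity ν t q)
        ∂((ν.prod ν).withDensity fun q => ENNReal.ofReal (condDensity ν s q)) ≤
      ∫ q, -Real.log (condDensity ν s q)
        ∂((ν.prod ν).withDensity fun q => ENNReal.ofReal (condDensity ν s q))) :
    ∀ᵐ q ∂(ν.prod ν), condDensity ν s q = condDensity ν t q := by
  have hPm := measurable_condDensity (ν := ν) hs
  have hP0 : ∀ q, 0 < condDensity ν s q := fun q => hm.trans_le (le_condDensity hm hs hs0 hs1 q)
  have hQ0 : ∀ q, 0 < condDensity ν t q := fun q => hm.trans_le (le_condDensity hm ht ht0 ht1 q)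
  have hconv : ∀ φ : A × A → ℝ, ∫ q, φ q
      ∂((ν.prod ν).withDensity fun q => ENNReal.ofReal (condDensity ν s q)) =
      ∫ q, condDensity ν s q * φ q ∂(ν.prod ν) := fun φ => by
    rw [integral_withDensity_eq_integral_toReal_smul hPm.ennreal_ofReal
      (ae_of_all _ fun q => ENNReal.ofReal_lt_top)]
    simp only [ENNReal.toReal_ofReal (hP0 _).le, smul_eq_mul]
  rw [hconv, hconv] at hle
  have hint : ∀ r : A × A → ℝ, Measurable r → (∀ q, m ≤ r q) → (∀ q, r q ≤ 1) →
      Integrable (fun q => condDensity ν s q * -Real.log (condDensity ν r q)) (ν.prod ν) :=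
    fun r hr hr0 hr1 => by
      refine (integrable_log_condDensity hm hr hr0 hr1).neg.bdd_mul (c := m⁻¹)
        hPm.aestronglyMeasurable (ae_of_all _ fun q => ?_)
      rw [Real.norm_of_nonneg (hP0 q).le]
      exact condDensity_le hm hs hs0 hs1 q
  have hIt := hint t ht ht0 ht1
  have hIs := hint s hs hs0 hs1
  have hP := integrable_condDensity (ν := ν) hm hs hs0 hs1 (μ := ν.prod ν)
  have hQ := integrable_condDensity (ν := ν) hm ht ht0 ht1 (μ := ν.prod ν)
  -- Subtracting `p - q`, which integrates to zero, turns the relative-entropy integrand into a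
  -- pointwise nonnegative one: `log u ≤ u - 1` at `u = q / p`, with equality only for `u = 1`.
  have hform : ∀ p q : ℝ, 0 < p → 0 < q →
      p * -Real.log q - p * -Real.log p - (p - q) = p * (q / p - 1 - Real.log (q / p)) :=
    fun p q hp hq => by
      rw [Real.log_div hq.ne' hp.ne']
      field_simp
      ring
  have hD0 : ∀ q, 0 ≤ condDensity ν s q * -Real.log (condDensity ν t q)
      - condDensity ν s q * -Real.log (condDensity ν s q)
      - (condDensity ν s q - condDensity ν t q) := fun q => by
    rw [hform _ _ (hP0 q) (hQ0 q)]
    exact mul_nonneg (hP0 q).le (sub_nonneg.2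
      (Real.log_le_sub_one_of_pos (div_pos (hQ0 q) (hP0 q))))
  have hD : ∫ q, (condDensity ν s q * -Real.log (condDensity ν t q)
      - condDensity ν s q * -Real.log (condDensity ν s q)
      - (condDensity ν s q - condDensity ν t q)) ∂(ν.prod ν) = 0 := by
    refine le_antisymm ?_ (integral_nonneg hD0)
    have hIts : Integrable (fun q => condDensity ν s q * -Real.log (condDensity ν t q)
      - condDensity ν s q * -Real.log (condDensity ν s q)) (ν.prod ν) := hIt.sub hIs
    have hPQ : Integrable (fun q => condDensity ν s q - condDensity ν t q) (ν.prod ν) := hP.sub hQ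
    rw [integral_sub hIts hPQ, integral_sub hIt hIs, integral_sub hP hQ,
      integral_condDensity hm hs hs0 hs1, integral_condDensity hm ht ht0 ht1]
    linarith
  rw [integral_eq_zero_iff_of_nonneg hD0 ((hIt.sub hIs).sub (hP.sub hQ))] at hD
  filter_upwards [hD] with q hq
  by_contra hne
  have hq : condDensity ν s q * -Real.log (condDensity ν t q)
      - condDensity ν s q * -Real.log (condDensity ν s q)
      - (condDensity ν s q - condDensity ν t q) = 0 := hq
  rw [hform _ _ (hP0 q) (hQ0 q)] at hq
  have := Real.log_lt_sub_one_of_pos (div_pos (hQ0 q) (hP0 q))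
    fun h => hne ((div_eq_one_iff_eq (hP0 q).ne').1 h).symm
  exact (mul_pos (hP0 q) (sub_pos.2 this)).ne' hq

/-- The variance of the sum is at most `M / 4`, and `M` suffices; `|y| ≤ √M / 2 + y ^ 2 / (2 * √M)`
passes from second to first moments. -/
theorem integral_abs_sum_sub_le (M : ℕ) (hM : 0 < M) {X : A → ℝ} (hX : Measurable X)
    (h0 : ∀ x, 0 ≤ X x) (h1 : ∀ x, X x ≤ 1) :
    ∫ ω : Fin M → A, |∑ i, X (ω i) - M * ∫ x, X x ∂ν| ∂(Measure.pi fun _ => ν) ≤ √M := by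
  have hMpos : (0 : ℝ) < M := by exact_mod_cast hM
  have hr : 0 < √(M : ℝ) := Real.sqrt_pos.2 hMpos
  have hrr : √(M : ℝ) * √(M : ℝ) = M := Real.mul_self_sqrt hMpos.le
  have hX2 : MemLp X 2 ν := MemLp.of_bound hX.aestronglyMeasurable 1 (ae_of_all _ fun x => by
    rw [Real.norm_of_nonneg (h0 x)]; exact h1 x)
  set S := ∫ x, X x ∂ν
  have hYm : Measurable fun ω : Fin M → A => ∑ i, X (ω i) :=
    Finset.measurable_sum _ fun i _ => hX.comp (measurable_pi_apply i)
  have hYl : ∀ ω : Fin M → A, 0 ≤ ∑ i, X (ω i) := fun ω => Finset.sum_nonneg fun i _ => h0 _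
  have hYu : ∀ ω : Fin M → A, ∑ i, X (ω i) ≤ M := fun ω => by
    simpa using Finset.sum_le_sum fun i (_ : i ∈ Finset.univ) => h1 (ω i)
  have hY2 : MemLp (fun ω : Fin M → A => ∑ i, X (ω i)) 2 (Measure.pi fun _ => ν) :=
    MemLp.of_bound hYm.aestronglyMeasurable M (ae_of_all _ fun ω => by
      rw [Real.norm_of_nonneg (hYl ω)]; exact hYu ω)
  have hmean : ∫ ω : Fin M → A, ∑ i, X (ω i) ∂(Measure.pi fun _ => ν) = M * S := by
    have hi : ∀ i ∈ Finset.univ, Integrable (fun ω : Fin M → A => X (ω i))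
        (Measure.pi fun _ => ν) := fun i _ => integrable_of_le_of_le
      (hX.comp (measurable_pi_apply i)) (fun ω => h0 (ω i)) fun ω => h1 (ω i)
    rw [integral_finsetSum _ hi]
    simp [integral_comp_eval (μ := fun _ : Fin M => ν) hX.aestronglyMeasurable, S]
  have hvar : ∫ ω : Fin M → A, (∑ i, X (ω i) - M * S) ^ 2 ∂(Measure.pi fun _ => ν) ≤ M := by
    have hv := ProbabilityTheory.variance_sum_pi (μ := fun _ : Fin M => ν) (fun _ => hX2)
    have hfun : (∑ i, fun ω : Fin M → A => X (ω i)) = fun ω => ∑ i, X (ω i) := by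
      ext ω; simp
    rw [hfun, ProbabilityTheory.variance_eq_integral hYm.aemeasurable, hmean] at hv
    rw [hv]
    have hb := ProbabilityTheory.variance_le_sq_of_bounded (μ := ν) (a := 0) (b := 1) (X := X)
      (ae_of_all _ fun x => ⟨h0 x, h1 x⟩) hX.aemeasurable
    simp only [Finset.sum_const, Finset.card_univ, Fintype.card_fin, nsmul_eq_mul]
    nlinarith
  have hI2 : Integrable (fun ω : Fin M → A => (∑ i, X (ω i) - M * S) ^ 2)
      (Measure.pi fun _ => ν) := (hY2.sub (memLp_const _)).integrable_sq
  calc ∫ ω : Fin M → A, |∑ i, X (ω i) - M * S| ∂(Measure.pi fun _ => ν)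
      ≤ ∫ ω : Fin M → A, (√M / 2 + (2 * √M)⁻¹ * (∑ i, X (ω i) - M * S) ^ 2)
          ∂(Measure.pi fun _ => ν) := by
        refine integral_mono_of_nonneg (ae_of_all _ fun ω => abs_nonneg _)
          ((integrable_const _).add (hI2.const_mul _)) (ae_of_all _ fun ω => ?_)
        have h := sq_nonneg (|∑ i, X (ω i) - M * S| - √M)
        beta_reduce
        rw [← sq_abs (∑ i, X (ω i) - M * S)]
        have h3 : √(M : ℝ) / 2 + (2 * √M)⁻¹ * |∑ i, X (ω i) - M * S| ^ 2
            - |∑ i, X (ω i) - M * S| =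
            (2 * √M)⁻¹ * (|∑ i, X (ω i) - M * S| - √M) ^ 2 := by
          field_simp
          ring
        have : 0 ≤ (2 * √(M : ℝ))⁻¹ * (|∑ i, X (ω i) - M * S| - √M) ^ 2 := by positivity
        linarith
    _ = √M / 2 + (2 * √M)⁻¹ * ∫ ω : Fin M → A, (∑ i, X (ω i) - M * S) ^ 2
          ∂(Measure.pi fun _ => ν) := by
        rw [integral_add (integrable_const _) (hI2.const_mul _), integral_const_mul]
        simp
    _ ≤ √M / 2 + (2 * √M)⁻¹ * (√M * √M) := by rw [hrr]; gcongr
    _ = √M := by field_simp; ring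

/-- The contrastive loss with `M` negative samples, minus `log M`, converges to the cross-entropy
of the normalized kernel. -/
theorem tendsto_contrastive_sub_log (P : Measure (A × A)) [IsProbabilityMeasure P] (hm : 0 < m)
    (hs : Measurable s) (h0 : ∀ q, m ≤ s q) (h1 : ∀ q, s q ≤ 1) :
    Tendsto (fun M : ℕ => (∫ ω : (A × A) × (Fin M → A),
        -Real.log (s ω.1 / (s ω.1 + ∑ i, s (ω.2 i, ω.1.2)))
          ∂(P.prod (Measure.pi fun _ => ν))) - Real.log M)
      atTop (nhds (∫ q, -Real.log (condDensity ν s q) ∂P)) := by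
  have hlim : Tendsto (fun M : ℕ => (1 + √(M : ℝ)) / (m * M)) atTop (nhds 0) := by
    have e1 : Tendsto (fun M : ℕ => (M : ℝ)⁻¹) atTop (nhds 0) := tendsto_inv_atTop_nhds_zero_nat
    have e2 : Tendsto (fun M : ℕ => (√(M : ℝ))⁻¹) atTop (nhds 0) := by
      simpa [Function.comp_def] using (Real.continuous_sqrt.tendsto 0).comp e1
    have := (e1.add e2).const_mul m⁻¹
    simp only [add_zero, mul_zero] at this
    refine this.congr' ?_
    filter_upwards [eventually_gt_atTop 0] with M hM
    have hMpos : (0 : ℝ) < M := by exact_mod_cast hM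
    have hr : 0 < √(M : ℝ) := Real.sqrt_pos.2 hMpos
    have hrr : (√(M : ℝ))⁻¹ = √M / M := by
      rw [eq_div_iff hMpos.ne', ← Real.mul_self_sqrt hMpos.le]; field_simp; simp
    rw [hrr]
    field_simp
  rw [tendsto_iff_norm_sub_tendsto_zero]
  refine squeeze_zero' (Eventually.of_forall fun _ => norm_nonneg _) ?_ hlim
  filter_upwards [eventually_gt_atTop 0] with M hM
  have hMpos : (0 : ℝ) < M := by exact_mod_cast hM
  set π : Measure (Fin M → A) := Measure.pi fun _ => ν
  set S : A → ℝ := fun x' => ∫ w, s (w, x') ∂ν with hS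
  have hSm : Measurable S := measurable_integral_kernel hs
  have hSl : ∀ x', m ≤ S x' := le_integral_kernel hs h0 h1
  have hSu : ∀ x', S x' ≤ 1 := integral_kernel_le hs h0 h1
  set Y : (A × A) × (Fin M → A) → ℝ := fun ω => ∑ i, s (ω.2 i, ω.1.2) with hY
  have hYm : Measurable Y := by
    refine Finset.measurable_sum _ fun i _ => hs.comp ?_
    fun_prop
  have hYl : ∀ ω, m * M ≤ Y ω := fun ω => by
    have := Finset.sum_le_sum fun i (_ : i ∈ Finset.univ) => h0 (ω.2 i, ω.1.2)
    simp only [Finset.sum_const, Finset.card_univ, Fintype.card_fin, nsmul_eq_mul] at this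
    rwa [mul_comm]
  have hYu : ∀ ω, Y ω ≤ M := fun ω => by
    simpa using Finset.sum_le_sum fun i (_ : i ∈ Finset.univ) => h1 (ω.2 i, ω.1.2)
  set T : (A × A) × (Fin M → A) → ℝ := fun ω => Y ω - M * S ω.1.2 with hT
  have hTm : Measurable T := by fun_prop
  have hTb : ∀ ω, |T ω| ≤ M := fun ω => by
    have e1 := hYu ω
    have e2 := hYl ω
    have e3 : M * S ω.1.2 ≤ M := mul_le_of_le_one_right hMpos.le (hSu _)
    have e4 : 0 ≤ M * S ω.1.2 := mul_nonneg hMpos.le (hm.le.trans (hSl _))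
    have e5 : 0 ≤ m * M := by positivity
    rw [abs_le]
    constructor <;> simp only [hT] <;> linarith
  have hTi : Integrable (fun ω => |T ω|) (P.prod π) :=
    integrable_of_le_of_le hTm.abs (fun ω => abs_nonneg _) hTb
  have hTint : ∫ ω, |T ω| ∂(P.prod π) ≤ √M := by
    rw [integral_prod _ hTi]
    refine (integral_mono (hTi.integral_prod_left) (integrable_const (√(M : ℝ)))
      fun q => ?_).trans (by simp)
    exact integral_abs_sum_sub_le M hM (hs.comp measurable_prodMk_right)
      (fun x => hm.le.trans (h0 (x, q.2))) fun x => h1 (x, q.2)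
  -- The only error term: the loss integrand is exactly `D + log M - log (condDensity ν s)`. Both
  -- logarithms are taken on `[m * M, ∞)`, where `log` has Lipschitz constant `1 / (m * M)`.
  set D : (A × A) × (Fin M → A) → ℝ := fun ω =>
    Real.log (s ω.1 + Y ω) - Real.log (M * S ω.1.2) with hD
  have hDm : Measurable D := by fun_prop
  have hDb : ∀ ω, ‖D ω‖ ≤ (1 + |T ω|) / (m * M) := fun ω => by
    have hs0 : 0 ≤ s ω.1 := hm.le.trans (h0 _)
    refine (Real.abs_log_sub_log_le (m := m * M) (by positivity) ?_ ?_).trans ?_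
    · linarith [hYl ω]
    · rw [mul_comm]; exact mul_le_mul_of_nonneg_left (hSl _) hMpos.le
    · gcongr
      rw [add_sub_assoc]
      refine (abs_add_le _ _).trans ?_
      gcongr
      rw [abs_of_nonneg hs0]
      exact h1 _
  have hgi : Integrable (fun ω => (1 + |T ω|) / (m * M)) (P.prod π) :=
    ((integrable_const 1).add hTi).div_const _
  have hDi : Integrable D (P.prod π) := hgi.mono' hDm.aestronglyMeasurable (ae_of_all _ hDb)
  have hji : Integrable (fun q => -Real.log (condDensity ν s q)) P :=
    (integrable_log_condDensity hm hs h0 h1).neg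
  have hterm : ∀ ω : (A × A) × (Fin M → A),
      -Real.log (s ω.1 / (s ω.1 + ∑ i, s (ω.2 i, ω.1.2))) =
        D ω + Real.log M + -Real.log (condDensity ν s ω.1) := fun ω => by
    have hs0 : 0 < s ω.1 := hm.trans_le (h0 _)
    have hY0 : 0 < Y ω := lt_of_lt_of_le (by positivity) (hYl ω)
    have hS0 : 0 < S ω.1.2 := hm.trans_le (hSl _)
    change -Real.log (s ω.1 / (s ω.1 + Y ω)) = _ + -Real.log (s ω.1 / S ω.1.2)
    simp only [hD]
    rw [Real.log_div hs0.ne' (by positivity), Real.log_div hs0.ne' hS0.ne',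
      Real.log_mul hMpos.ne' hS0.ne']
    ring
  have hval : ∫ ω : (A × A) × (Fin M → A),
      -Real.log (s ω.1 / (s ω.1 + ∑ i, s (ω.2 i, ω.1.2))) ∂(P.prod π) =
      (∫ ω, D ω ∂(P.prod π)) + Real.log M + ∫ q, -Real.log (condDensity ν s q) ∂P := by
    have hDM : Integrable (fun ω => D ω + Real.log M) (P.prod π) := hDi.add (integrable_const _)
    simp only [hterm]
    rw [integral_add hDM (hji.comp_fst π),
      integral_add hDi (integrable_const _),
      integral_fun_fst (μ := P) (ν := π) (fun q => -Real.log (condDensity ν s q))]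
    simp
  rw [hval, show ∀ a b c : ℝ, a + b + c - b - c = a by intros; ring]
  refine (norm_integral_le_of_norm_le hgi (ae_of_all _ hDb)).trans ?_
  rw [integral_div, integral_add (integrable_const _) hTi]
  simp only [integral_const, probReal_univ, smul_eq_mul, mul_one]
  gcongr

end Kernel

/-! ### `ℓ^α` similarities -/

namespace IsLpSimilarity

variable {N : ℕ} {α : ℝ≥0∞} {δ : (Fin N → ℝ) → (Fin N → ℝ) → ℝ}

theorem continuous (hα : 1 ≤ α) (hδ : IsLpSimilarity α δ) :
    Continuous fun q : (Fin N → ℝ) × (Fin N → ℝ) => δ q.1 q.2 := by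
  have : Fact (1 ≤ α) := ⟨hα⟩
  have hc : Continuous fun q : (Fin N → ℝ) × (Fin N → ℝ) => lpMetric α q.1 q.2 :=
    ((PiLp.continuous_toLp α _).comp continuous_fst).dist
      ((PiLp.continuous_toLp α _).comp continuous_snd)
  rcases hδ with h | ⟨-, h⟩
  · simpa only [h] using hc
  · simpa only [h] using hc.rpow_const fun q => Or.inr ENNReal.toReal_nonneg

theorem nonneg (hα : 1 ≤ α) (hδ : IsLpSimilarity α δ) (x y : Fin N → ℝ) : 0 ≤ δ x y := by
  have : Fact (1 ≤ α) := ⟨hα⟩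
  have hd : 0 ≤ lpMetric α x y := dist_nonneg
  rcases hδ with h | ⟨-, h⟩
  · rwa [h]
  · rw [h]; exact Real.rpow_nonneg hd _

theorem self (hα : 1 ≤ α) (hδ : IsLpSimilarity α δ) (x : Fin N → ℝ) : δ x x = 0 := by
  have : Fact (1 ≤ α) := ⟨hα⟩
  have hd : lpMetric α x x = 0 := dist_self _
  rcases hδ with h | ⟨hαt, h⟩
  · rwa [h]
  · rw [h, hd]
    exact Real.zero_rpow (ENNReal.toReal_pos (by rintro rfl; simp at hα) hαt).ne'

/-- The constant is `k` for the metric itself and `k ^ (1 / α)` for its `α`-th power. -/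
theorem exists_lpMetric_scale (hα : 1 ≤ α) (hδ : IsLpSimilarity α δ) {k : ℝ} (hk : 0 < k) :
    ∃ c : ℝ, 0 < c ∧ ∀ x y u v : Fin N → ℝ, δ x y = k * δ u v →
      lpMetric α x y = c * lpMetric α u v := by
  have : Fact (1 ≤ α) := ⟨hα⟩
  rcases hδ with h | ⟨hαt, h⟩
  · exact ⟨k, hk, fun x y u v huv => by simpa only [h] using huv⟩
  · have hp : 0 < α.toReal := ENNReal.toReal_pos (by rintro rfl; simp at hα) hαt
    refine ⟨k ^ α.toReal⁻¹, by positivity, fun x y u v huv => ?_⟩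
    have hd : ∀ x y : Fin N → ℝ, 0 ≤ lpMetric α x y := fun x y => dist_nonneg
    simp only [h] at huv
    rw [← Real.rpow_left_inj (hd _ _) (mul_nonneg (by positivity) (hd _ _)) hp.ne', huv,
      Real.mul_rpow (by positivity) (hd _ _), ← Real.rpow_mul hk.le, inv_mul_cancel₀ hp.ne',
      Real.rpow_one]

end IsLpSimilarity

/-- The kernel `exp (-δ / τ)`, pulled back along `H`. -/
noncomputable def simKernel {A B : Type*} (δ : B → B → ℝ) (τ : ℝ) (H : A → B) (q : A × A) : ℝ :=
  Real.exp (-δ (H q.1) (H q.2) / τ)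

section SimKernel

variable {N : ℕ} {α : ℝ≥0∞} {δ : (Fin N → ℝ) → (Fin N → ℝ) → ℝ} {τ : ℝ}

theorem measurable_simKernel (hα : 1 ≤ α) (hδ : IsLpSimilarity α δ) {A : Type*}
    [MeasurableSpace A] {H : A → Fin N → ℝ} (hH : Measurable H) :
    Measurable (simKernel δ τ H) := by
  have h := (hδ.continuous hα).measurable.comp
    ((hH.comp measurable_fst).prodMk (hH.comp measurable_snd))
  exact Real.measurable_exp.comp (h.neg.div_const τ)

theorem simKernel_le_one (hα : 1 ≤ α) (hδ : IsLpSimilarity α δ) (hτ : 0 < τ) {A : Type*}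
    (H : A → Fin N → ℝ) (q : A × A) : simKernel δ τ H q ≤ 1 := by
  rw [simKernel, Real.exp_le_one_iff, neg_div]
  exact neg_nonpos.2 (div_nonneg (hδ.nonneg hα _ _) hτ.le)

/-- The bound is the minimum over the compact `W × W`, hence uniform in `H`. -/
theorem exists_le_simKernel (hα : 1 ≤ α) (hδ : IsLpSimilarity α δ) (τ : ℝ)
    {W : Set (Fin N → ℝ)} (hW : IsCompact W) (hWn : W.Nonempty) :
    ∃ m : ℝ, 0 < m ∧ ∀ {A : Type} (H : A → Fin N → ℝ), (∀ a, H a ∈ W) →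
      ∀ q, m ≤ simKernel δ τ H q := by
  have hc : Continuous fun q : (Fin N → ℝ) × (Fin N → ℝ) => Real.exp (-δ q.1 q.2 / τ) :=
    Real.continuous_exp.comp ((hδ.continuous hα).neg.div_const τ)
  obtain ⟨q, -, hq⟩ := (hW.prod hW).exists_isMinOn (hWn.prod hWn) hc.continuousOn
  exact ⟨_, Real.exp_pos _, fun H hH r => hq (a := (H r.1, H r.2)) ⟨hH _, hH _⟩⟩

end SimKernel

/-! ### The uniform law on a convex body -/

namespace IsConvexBody

variable {N : ℕ} {Z : Set (Fin N → ℝ)}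

theorem measurableSet (hZ : IsConvexBody Z) : MeasurableSet Z := hZ.2.1.measurableSet

theorem nonempty (hZ : IsConvexBody Z) : Z.Nonempty := hZ.2.2.mono interior_subset

theorem volume_ne_zero (hZ : IsConvexBody Z) : volume Z ≠ 0 :=
  (Measure.measure_pos_of_nonempty_interior volume hZ.2.2).ne'

theorem volume_ne_top (hZ : IsConvexBody Z) : volume Z ≠ ⊤ := hZ.2.1.measure_ne_top

theorem isProbabilityMeasure_uniformLaw (hZ : IsConvexBody Z) :
    IsProbabilityMeasure (uniformLaw Z) :=
  ProbabilityTheory.cond_isProbabilityMeasure_of_finite hZ.volume_ne_zero hZ.volume_ne_top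

theorem restrict_eq_smul_uniformLaw (hZ : IsConvexBody Z) :
    volume.restrict Z = volume Z • uniformLaw Z := by
  rw [uniformLaw, ProbabilityTheory.cond, smul_smul,
    ENNReal.mul_inv_cancel hZ.volume_ne_zero hZ.volume_ne_top, one_smul]

theorem ae_mem (hZ : IsConvexBody Z) : ∀ᵐ z ∂(uniformLaw Z), z ∈ Z :=
  Measure.ae_smul_measure (ae_restrict_mem hZ.measurableSet) _

theorem ae_prod_mem (hZ : IsConvexBody Z) :
    ∀ᵐ q ∂((uniformLaw Z).prod (uniformLaw Z)), q.1 ∈ Z ∧ q.2 ∈ Z := by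
  have := hZ.isProbabilityMeasure_uniformLaw
  exact (Measure.quasiMeasurePreserving_fst.ae hZ.ae_mem).and
    (Measure.quasiMeasurePreserving_snd.ae hZ.ae_mem)

/-- A convex set with non-empty interior lies in the closure of its interior, so null sets cannot
hide a point of disagreement, even on the boundary. -/
theorem eqOn_of_ae_eq (hZ : IsConvexBody Z) {u v : (Fin N → ℝ) → ℝ} (hu : ContinuousOn u Z)
    (hv : ContinuousOn v Z) (h : ∀ᵐ z ∂(uniformLaw Z), u z = v z) : EqOn u v Z := by
  refine Measure.eqOn_of_ae_eq (μ := volume) ?_ hu hv ?_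
  · rw [hZ.restrict_eq_smul_uniformLaw]
    exact Measure.ae_smul_measure h _
  · rw [hZ.1.closure_interior_eq_closure_of_nonempty_interior hZ.2.2]
    exact subset_closure

theorem condDensity_congr (hZ : IsConvexBody Z) {s t : (Fin N → ℝ) × (Fin N → ℝ) → ℝ}
    (hst : ∀ z ∈ Z, ∀ z' ∈ Z, s (z, z') = t (z, z')) {z z' : Fin N → ℝ} (hz : z ∈ Z)
    (hz' : z' ∈ Z) :
    condDensity (uniformLaw Z) s (z, z') = condDensity (uniformLaw Z) t (z, z') := by
  simp only [condDensity]
  rw [hst z hz z' hz', integral_congr_ae (hZ.ae_mem.mono fun w hw => hst w hw z' hz')]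

/-- The volume of `Z` cancels between reference measure and normalizer. Since `s` is free off `Z`, a
kernel with global bounds can be chosen. -/
theorem latentPairLaw_eq (hZ : IsConvexBody Z) {δ : (Fin N → ℝ) → (Fin N → ℝ) → ℝ} {lam : ℝ}
    {s : (Fin N → ℝ) × (Fin N → ℝ) → ℝ}
    (hs : ∀ z ∈ Z, ∀ z' ∈ Z, s (z, z') = Real.exp (-(lam * δ z z'))) :
    latentPairLaw Z δ lam = ((uniformLaw Z).prod (uniformLaw Z)).withDensity
      fun q => ENNReal.ofReal (condDensity (uniformLaw Z) s q) := by
  have := hZ.isProbabilityMeasure_uniformLaw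
  rw [latentPairLaw, hZ.restrict_eq_smul_uniformLaw, Measure.prod_smul_left,
    withDensity_smul_measure, ← withDensity_smul' _ _ hZ.volume_ne_top]
  refine withDensity_congr_ae (hZ.ae_prod_mem.mono fun q hq => ?_)
  have hV : 0 < (volume Z).toReal := ENNReal.toReal_pos hZ.volume_ne_zero hZ.volume_ne_top
  have hint : ∫ w in Z, Real.exp (-(lam * δ w q.2)) =
      (volume Z).toReal * ∫ w, s (w, q.2) ∂(uniformLaw Z) := by
    rw [setIntegral_congr_fun hZ.measurableSet fun w hw => (hs w hw q.2 hq.2).symm,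
      hZ.restrict_eq_smul_uniformLaw, integral_smul_measure, smul_eq_mul]
  simp only [Pi.smul_apply, smul_eq_mul, trueCond, condDensity, hint]
  rw [← hs q.1 hq.1 q.2 hq.2, ← ENNReal.ofReal_toReal hZ.volume_ne_top,
    ← ENNReal.ofReal_mul ENNReal.toReal_nonneg, ENNReal.ofReal_toReal hZ.volume_ne_top]
  congr 1
  field_simp

end IsConvexBody

/-! ### Encoders -/

/-- On a compact set `g` is a closed map onto its image, hence a quotient map. -/
theorem continuousOn_image_of_comp {E F G : Type*} [TopologicalSpace E] [TopologicalSpace F]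
    [T2Space F] [TopologicalSpace G] {Z : Set E} (hZ : IsCompact Z) {g : E → F}
    (hg : ContinuousOn g Z) {φ : F → G} (hφ : ContinuousOn (φ ∘ g) Z) :
    ContinuousOn φ (g '' Z) := by
  rw [continuousOn_iff_isClosed]
  intro t ht
  obtain ⟨u, hu, hut⟩ := continuousOn_iff_isClosed.1 hφ t ht
  have hK : IsCompact (u ∩ Z) := hZ.inter_left hu
  refine ⟨g '' (u ∩ Z), (hK.image_of_continuousOn (hg.mono inter_subset_right)).isClosed, ?_⟩
  ext y
  constructor
  · rintro ⟨hy, z, hz, rfl⟩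
    have : z ∈ u ∩ Z := hut ▸ ⟨hy, hz⟩
    exact ⟨mem_image_of_mem g this, mem_image_of_mem g hz⟩
  · rintro ⟨⟨z, hz, rfl⟩, hy⟩
    have : z ∈ (φ ∘ g) ⁻¹' t ∩ Z := hut.symm ▸ hz
    exact ⟨this.1, hy⟩

/-- In the limit of infinitely many negative samples, the contrastive loss of an encoder is, up to
`log M`, the cross-entropy of the conditional density it induces on the latents. -/
theorem exists_tendsto_contrastiveLoss_sub_log {N K : ℕ} {Z Z' : Set (Fin N → ℝ)}
    (hZ : IsConvexBody Z) (hZ' : IsConvexBody Z') {α : ℝ≥0∞} (hα : 1 ≤ α)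
    {δ : (Fin N → ℝ) → (Fin N → ℝ) → ℝ} (hδ : IsLpSimilarity α δ) {lam τ : ℝ} (hτ : 0 < τ)
    (hprob : IsProbabilityMeasure (latentPairLaw Z δ lam))
    (hmem : ∀ᵐ q ∂(latentPairLaw Z δ lam), q.1 ∈ Z ∧ q.2 ∈ Z)
    {g : (Fin N → ℝ) → (Fin K → ℝ)} (hg : ContinuousOn g Z) {φ : (Fin K → ℝ) → (Fin N → ℝ)}
    (hφ : ContinuousOn (φ ∘ g) Z) (hφZ : MapsTo (φ ∘ g) Z Z') :
    ∃ H : (Fin N → ℝ) → (Fin N → ℝ), Measurable H ∧ (∀ z, H z ∈ Z') ∧ EqOn H (φ ∘ g) Z ∧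
      Tendsto (fun M : ℕ => contrastiveLoss δ τ (posLaw Z δ lam g) (dataLaw Z g) φ M - Real.log M)
        atTop (nhds (∫ q, -Real.log (condDensity (uniformLaw Z) (simKernel δ τ H) q)
          ∂(latentPairLaw Z δ lam))) := by
  classical
  have := hZ.isProbabilityMeasure_uniformLaw
  obtain ⟨w, hw⟩ := hZ'.nonempty
  have hgZ : MeasurableSet (g '' Z) := (hZ.2.1.image_of_continuousOn hg).measurableSet
  -- Nothing is known of `g` off `Z` or of `φ` off `g '' Z`, not even measurability. The laws see
  -- only these sets, so both maps are replaced by Borel ones, constant elsewhere.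
  set G : (Fin N → ℝ) → (Fin K → ℝ) := Z.piecewise g fun _ => 0 with hGdef
  have hG : Measurable G := hg.measurable_piecewise continuousOn_const hZ.measurableSet
  have hGg : EqOn G g Z := piecewise_eqOn _ _ _
  set Φ : (Fin K → ℝ) → (Fin N → ℝ) := (g '' Z).piecewise φ fun _ => w with hΦdef
  have hΦ : Measurable Φ :=
    (continuousOn_image_of_comp hZ.2.1 hg hφ).measurable_piecewise continuousOn_const hgZ
  have hΦφ : EqOn Φ φ (g '' Z) := piecewise_eqOn _ _ _
  have hΦZ : ∀ x, Φ x ∈ Z' := fun x => by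
    by_cases hx : x ∈ g '' Z
    · rw [hΦφ hx]
      obtain ⟨z, hz, rfl⟩ := hx
      exact hφZ hz
    · rwa [hΦdef, piecewise_eq_of_notMem _ _ _ hx]
  refine ⟨Φ ∘ G, hΦ.comp hG, fun z => hΦZ _, fun z hz => ?_, ?_⟩
  · simp only [Function.comp, hGg hz, hΦφ (mem_image_of_mem g hz)]
  obtain ⟨m, hm, hml⟩ := exists_le_simKernel hα hδ τ hZ'.2.1 hZ'.nonempty
  have hs := measurable_simKernel (τ := τ) hα hδ hΦ
  have hs0 := hml Φ hΦZ
  have hs1 := simKernel_le_one hα hδ hτ Φ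
  have hGG : Measurable (Prod.map G G) := hG.prodMap hG
  have hdata : dataLaw Z g = (uniformLaw Z).map G :=
    Measure.map_congr (hZ.ae_mem.mono fun z hz => (hGg hz).symm)
  have hpos : posLaw Z δ lam g = (latentPairLaw Z δ lam).map (Prod.map G G) :=
    Measure.map_congr (hmem.mono fun q hq => by
      simp only [Prod.map, hGg hq.1, hGg hq.2])
  have hdataP : IsProbabilityMeasure (dataLaw Z g) := by
    rw [hdata]; exact Measure.isProbabilityMeasure_map hG.aemeasurable
  have hposP : IsProbabilityMeasure (posLaw Z δ lam g) := by
    rw [hpos]; exact Measure.isProbabilityMeasure_map hGG.aemeasurable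
  have hdmem : ∀ᵐ x ∂(dataLaw Z g), x ∈ g '' Z := by
    rw [hdata]
    exact (ae_map_iff hG.aemeasurable hgZ).2 <| hZ.ae_mem.mono fun z hz => by rw [hGg hz]; exact mem_image_of_mem g hz
  have hpmem : ∀ᵐ q ∂(posLaw Z δ lam g), q ∈ (g '' Z) ×ˢ (g '' Z) := by
    rw [hpos]
    refine (ae_map_iff hGG.aemeasurable (hgZ.prod hgZ)).2 (hmem.mono fun q hq => ?_)
    refine ⟨?_, ?_⟩
    · change G q.1 ∈ _
      rw [hGg hq.1]; exact mem_image_of_mem g hq.1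
    · change G q.2 ∈ _
      rw [hGg hq.2]; exact mem_image_of_mem g hq.2
  have hloss : ∀ M : ℕ, contrastiveLoss δ τ (posLaw Z δ lam g) (dataLaw Z g) φ M =
      ∫ ω : ((Fin K → ℝ) × (Fin K → ℝ)) × (Fin M → Fin K → ℝ),
        -Real.log (simKernel δ τ Φ ω.1 /
          (simKernel δ τ Φ ω.1 + ∑ i, simKernel δ τ Φ (ω.2 i, ω.1.2)))
          ∂((posLaw Z δ lam g).prod (Measure.pi fun _ => dataLaw Z g)) := fun M => by
    have h2 : ∀ᵐ x ∂(Measure.pi fun _ : Fin M => dataLaw Z g), ∀ i, x i ∈ g '' Z :=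
      ae_all_iff.2 fun i =>
        (measurePreserving_eval (fun _ : Fin M => dataLaw Z g) i).quasiMeasurePreserving.ae hdmem
    refine integral_congr_ae ?_
    filter_upwards [Measure.quasiMeasurePreserving_fst.ae hpmem,
      Measure.quasiMeasurePreserving_snd.ae h2] with ω h1 h2
    simp only [contrastiveTerm, simKernel, hΦφ h1.1, hΦφ h1.2, fun i => hΦφ (h2 i)]
  simp only [hloss]
  have hlim := tendsto_contrastive_sub_log (ν := dataLaw Z g) (posLaw Z δ lam g) hm hs hs0 hs1
  convert hlim using 2
  have hcm : Measurable fun q => -Real.log (condDensity (dataLaw Z g) (simKernel δ τ Φ) q) :=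
    (measurable_condDensity hs).log.neg
  conv_rhs => rw [hpos]
  rw [integral_map hGG.aemeasurable hcm.aestronglyMeasurable]
  refine integral_congr_ae (ae_of_all _ fun q => ?_)
  simp only [condDensity, hdata]
  have hint : ∫ w, simKernel δ τ Φ (w, G q.2) ∂((uniformLaw Z).map G) =
      ∫ w, simKernel δ τ Φ (G w, G q.2) ∂(uniformLaw Z) :=
    integral_map hG.aemeasurable (hs.comp measurable_prodMk_right).aestronglyMeasurable
  simp only [Prod.map, hint]
  rfl

theorem similarity_eq_of_modelCond_eq {N : ℕ} {Z : Set (Fin N → ℝ)} (hZ : IsConvexBody Z)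
    {α : ℝ≥0∞} (hα : 1 ≤ α) {δ : (Fin N → ℝ) → (Fin N → ℝ) → ℝ} (hδ : IsLpSimilarity α δ)
    {lam τ : ℝ} (hτ : 0 < τ) {h : (Fin N → ℝ) → (Fin N → ℝ)}
    (hmatch : ∀ z ∈ Z, ∀ z' ∈ Z, modelCond Z δ τ h z z' = trueCond Z δ lam z z') :
    ∀ z ∈ Z, ∀ z' ∈ Z, δ (h z) (h z') = τ * lam * δ z z' := by
  intro z hz z' hz'
  have hD : 0 < ∫ w in Z, Real.exp (-(lam * δ w z')) := by
    have : NeZero (volume.restrict Z) := ⟨by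
      simpa [Measure.restrict_eq_zero] using hZ.volume_ne_zero⟩
    have hc : Continuous fun w => Real.exp (-(lam * δ w z')) := by
      have := (hδ.continuous hα).comp (continuous_id.prodMk (continuous_const (y := z')))
      exact Real.continuous_exp.comp (continuous_const.mul this).neg
    exact integral_exp_pos (hc.continuousOn.integrableOn_compact hZ.2.1)
  have h1 := hmatch z' hz' z' hz'
  have h2 := hmatch z hz z' hz'
  simp only [modelCond, trueCond, hδ.self hα, neg_zero, mul_zero, zero_div, Real.exp_zero] at h1 h2
  have hCD : ∫ w in Z, Real.exp (-δ (h w) (h z') / τ) = ∫ w in Z, Real.exp (-(lam * δ w z')) := by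
    simpa using h1
  rw [hCD, div_left_inj' hD.ne', Real.exp_eq_exp, div_eq_iff hτ.ne'] at h2
  linarith

/-- Supplies the regularity of the matching encoder, which is not assumed continuous. -/
theorem continuousOn_of_lpMetric_eq {N : ℕ} {α : ℝ≥0∞} (hα : 1 ≤ α) {Z : Set (Fin N → ℝ)}
    {h : (Fin N → ℝ) → (Fin N → ℝ)} {c : ℝ}
    (hiso : ∀ z ∈ Z, ∀ w ∈ Z, lpMetric α (h z) (h w) = c * lpMetric α z w) :
    ContinuousOn h Z := by
  have : Fact (1 ≤ α) := ⟨hα⟩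
  intro w hw
  have key : Tendsto (fun z => WithLp.toLp α (h z)) (nhdsWithin w Z)
      (nhds (WithLp.toLp α (h w))) := by
    rw [tendsto_iff_dist_tendsto_zero]
    have h1 : Continuous fun z : Fin N → ℝ => c * dist (WithLp.toLp α z) (WithLp.toLp α w) :=
      continuous_const.mul ((PiLp.continuous_toLp α _).dist continuous_const)
    have h2 := h1.tendsto w
    rw [dist_self, mul_zero] at h2
    refine (h2.mono_left nhdsWithin_le_nhds).congr' ?_
    filter_upwards [self_mem_nhdsWithin] with z hz using (hiso z hz w hw).symm
  exact ((PiLp.continuous_ofLp α _).tendsto _).comp key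

/-! ### Identification of the latents -/

theorem theorem4 {N K : ℕ}
    -- latent space, model space, similarity measure
    (Z Z' : Set (Fin N → ℝ)) (hZ : IsConvexBody Z) (hZ' : IsConvexBody Z')
    (α : ℝ≥0∞) (hα : 1 ≤ α) (hα2 : α ≠ 2)
    (δ : (Fin N → ℝ) → (Fin N → ℝ) → ℝ) (hδ : IsLpSimilarity α δ)
    (lam τ : ℝ) (hlam : 0 < lam) (hτ : 0 < τ)
    -- mixing function
    (X : Set (Fin K → ℝ)) (g : (Fin N → ℝ) → (Fin K → ℝ)) (hgX : MapsTo g Z X)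
    (hginj : InjOn g Z) (hg : DifferentiableOn ℝ g Z)
    -- hypothesis class, flexible enough for the model conditional to match the true one
    (F : Set ((Fin K → ℝ) → (Fin N → ℝ))) (hF : ∀ f ∈ F, MapsTo f X Z')
    (hmatch : ∃ f₀ ∈ F, ∀ z ∈ Z, ∀ z' ∈ Z,
      modelCond Z δ τ (f₀ ∘ g) z z' = trueCond Z δ lam z z')
    -- the trained encoder
    (f : (Fin K → ℝ) → (Fin N → ℝ)) (hf : DifferentiableOn ℝ f X)
    (hmin : IsAsymptoticMinimizer
      (contrastiveLoss δ τ (posLaw Z δ lam g) (dataLaw Z g)) F f) :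
    ∃ (σ : Equiv.Perm (Fin N)) (s : Fin N → ℝ) (c : ℝ) (b : Fin N → ℝ),
      (∀ i, s i = 1 ∨ s i = -1) ∧ 0 < c ∧
        ∀ z ∈ Z, ∀ i, (f ∘ g) z i = c * (s i * z (σ i)) + b i := by
  classical
  obtain ⟨f₀, hf₀F, hf₀⟩ := hmatch
  have hU := hZ.isProbabilityMeasure_uniformLaw
  have hsim₀ := similarity_eq_of_modelCond_eq hZ hα hδ hτ hf₀
  obtain ⟨c, hc, hscale⟩ := hδ.exists_lpMetric_scale hα (mul_pos hτ hlam)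
  have hcont₀ : ContinuousOn (f₀ ∘ g) Z :=
    continuousOn_of_lpMetric_eq hα fun z hz z' hz' => hscale _ _ _ _ (hsim₀ z hz z' hz')
  have hh : DifferentiableOn ℝ (f ∘ g) Z := hf.comp hg hgX
  -- the true kernel
  obtain ⟨w, hw⟩ := hZ.nonempty
  -- Sending the complement of `Z` to a point of `Z` gives the true kernel, at temperature `lam⁻¹`,
  -- a positive lower bound on the whole space.
  set r : (Fin N → ℝ) → (Fin N → ℝ) := Z.piecewise id fun _ => w with hrdef
  have hr : Measurable r := measurable_id.piecewise hZ.measurableSet measurable_const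
  have hrid : ∀ z ∈ Z, r z = z := fun z hz => piecewise_eq_of_mem _ _ _ hz
  have hrZ : ∀ z, r z ∈ Z := fun z => by
    by_cases hz : z ∈ Z
    · rwa [hrid z hz]
    · rwa [hrdef, piecewise_eq_of_notMem _ _ _ hz]
  have hlam' : 0 < lam⁻¹ := inv_pos.2 hlam
  have hsr : ∀ z ∈ Z, ∀ z' ∈ Z,
      simKernel δ lam⁻¹ r (z, z') = Real.exp (-(lam * δ z z')) := fun z hz z' hz' => by
    simp only [simKernel, hrid z hz, hrid z' hz', div_inv_eq_mul]
    ring_nf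
  have hlaw := hZ.latentPairLaw_eq hsr
  obtain ⟨m₁, hm₁, hml₁⟩ := exists_le_simKernel hα hδ lam⁻¹ hZ.2.1 hZ.nonempty
  obtain ⟨m₂, hm₂, hml₂⟩ := exists_le_simKernel hα hδ τ hZ'.2.1 hZ'.nonempty
  have hs := measurable_simKernel (τ := lam⁻¹) hα hδ hr
  have hs1 := simKernel_le_one hα hδ hlam' r
  have hprob : IsProbabilityMeasure (latentPairLaw Z δ lam) := by
    rw [hlaw]
    exact isProbabilityMeasure_withDensity_condDensity hm₁ hs (hml₁ r hrZ) hs1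
  have hmem : ∀ᵐ q ∂(latentPairLaw Z δ lam), q.1 ∈ Z ∧ q.2 ∈ Z := by
    rw [hlaw]
    exact (withDensity_absolutelyContinuous _ _).ae_le hZ.ae_prod_mem
  -- comparison of the limiting losses
  obtain ⟨H₀, -, -, hH₀, hlim₀⟩ := exists_tendsto_contrastiveLoss_sub_log hZ hZ' hα hδ hτ hprob
    hmem hg.continuousOn hcont₀ ((hF f₀ hf₀F).comp hgX)
  obtain ⟨H, hHm, hHZ, hH, hlim⟩ := exists_tendsto_contrastiveLoss_sub_log hZ hZ' hα hδ hτ hprob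
    hmem hg.continuousOn hh.continuousOn ((hF f hmin.1).comp hgX)
  have hle := le_of_forall_pos_le_add fun ε hε => le_of_tendsto_of_tendsto hlim (hlim₀.add_const ε)
    ((hmin.2 f₀ hf₀F ε hε).mono fun M hM => by linarith)
  -- The limiting loss of the matching encoder is the entropy of the true conditional.
  have h₀ : ∫ q, -Real.log (condDensity (uniformLaw Z) (simKernel δ τ H₀) q)
        ∂(latentPairLaw Z δ lam) =
      ∫ q, -Real.log (condDensity (uniformLaw Z) (simKernel δ lam⁻¹ r) q)
        ∂(latentPairLaw Z δ lam) := by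
    refine integral_congr_ae (hmem.mono fun q hq => ?_)
    beta_reduce
    rw [← Prod.mk.eta (p := q), hZ.condDensity_congr (fun z hz z' hz' => ?_) hq.1 hq.2]
    rw [hsr z hz z' hz']
    simp only [simKernel, hH₀ hz, hH₀ hz']
    simp only [Function.comp] at hsim₀ ⊢
    rw [hsim₀ z hz z' hz']
    congr 1
    field_simp
  rw [h₀, hlaw] at hle
  have hae := condDensity_ae_eq_of_crossEntropy_le (lt_min hm₁ hm₂) hs
    (fun q => (min_le_left _ _).trans (hml₁ r hrZ q)) hs1 (measurable_simKernel hα hδ hHm)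
    (fun q => (min_le_right _ _).trans (hml₂ H hHZ q)) (simKernel_le_one hα hδ hτ H) hle
  -- the trained encoder recovers the similarity
  have hδc := hδ.continuous hα
  -- The swap makes the conditioning variable the outer one, so that the normalizers are constants
  -- in each section.
  have hae' := Measure.ae_ae_of_ae_prod
    ((Measure.measurePreserving_swap (μ := uniformLaw Z)
      (ν := uniformLaw Z)).quasiMeasurePreserving.ae hae)
  have hsec : ∀ᵐ z' ∂(uniformLaw Z), ∀ z ∈ Z,
      δ ((f ∘ g) z) ((f ∘ g) z') = τ * lam * δ z z' := by
    filter_upwards [hae', hZ.ae_mem] with z' hz' hz'Z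
    set S := ∫ w, simKernel δ lam⁻¹ r (w, z') ∂(uniformLaw Z) with hS
    set T := ∫ w, simKernel δ τ H (w, z') ∂(uniformLaw Z) with hT
    have hS0 : 0 < S := hm₁.trans_le (le_integral_kernel hs (hml₁ r hrZ) hs1 z')
    have heq : EqOn (fun z => Real.exp (-(lam * δ z z')) / S)
        (fun z => Real.exp (-δ ((f ∘ g) z) ((f ∘ g) z') / τ) / T) Z := by
      refine hZ.eqOn_of_ae_eq ?_ ?_ ?_
      · have : Continuous fun z => δ z z' := hδc.comp (continuous_id.prodMk continuous_const)
        fun_prop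
      · have : ContinuousOn (fun z => δ ((f ∘ g) z) ((f ∘ g) z')) Z :=
          hδc.comp_continuousOn (hh.continuousOn.prodMk continuousOn_const)
        exact (Real.continuous_exp.comp_continuousOn (this.neg.div_const τ)).div_const T
      · filter_upwards [hz', hZ.ae_mem] with z hz hzZ
        rw [← hsr z hzZ z' hz'Z]
        have hz : simKernel δ lam⁻¹ r (z, z') / S = simKernel δ τ H (z, z') / T := hz
        rw [hz]
        simp only [simKernel, hH hzZ, hH hz'Z]
    -- Evaluated at `z = z'`, where both numerators are `1`; this needs equality at every point of
    -- `Z`, not merely almost everywhere.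
    have hST : S = T := by simpa [hδ.self hα] using heq hz'Z
    intro z hz
    have h2 := heq hz
    simp only [← hST] at h2
    rw [div_left_inj' hS0.ne', Real.exp_eq_exp, eq_div_iff hτ.ne'] at h2
    linarith
  have hsim : ∀ z ∈ Z, ∀ z' ∈ Z, δ ((f ∘ g) z) ((f ∘ g) z') = τ * lam * δ z z' := by
    intro z hz
    refine hZ.eqOn_of_ae_eq (hδc.comp_continuousOn (continuousOn_const.prodMk hh.continuousOn)) ?_
      (hsec.mono fun z' hz' => hz' z hz)
    have : Continuous fun z' => δ z z' := hδc.comp (continuous_const.prodMk continuous_id)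
    fun_prop
  obtain ⟨σ, s, b, hs, hσ⟩ := exists_signed_perm_of_lpMetric_eq hα hα2 hZ.1 hZ.2.2 hh hc
    fun z hz z' hz' => hscale _ _ _ _ (hsim z hz z' hz')
  exact ⟨σ, s, c, b, hs, hc, hσ⟩
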